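/- A directed graph $E=(E^0,E^1,r,s)$ consists of a set $E^0$ of vertices, a set $E^1$ of edges, and range and source maps $r,s:E^1\to E^0$. It has no sinks if every vertex is the source of some edge, and no sources if every vertex is the range of some edge. Give $E^0$ the discrete topology. The graph correspondence $X(E)$ is the $C^*$-correspondence over $A=C_0(E^0)$ of all $\xi:E^1\to\mathbb C$ for which $v\mapsto\sum_{r(e)=v}|\xi(e)|^2$ is in $C_0(E^0)$, with $(a\cdot\xi)(e)=a(s(e))\xi(e)$, $(\xi\cdot b)(e)=\xi(e)b(r(e))$ and $\langle\xi,\eta\rangle(v)=\sum_{r(e)=v}\overline{\xi(e)}\eta(e)$. For a $C^*$-correspondence $X$ over a $C^*$-algebra $A$, let $X^{\otimes n}$ denote the $n$-fold $A$-balanced (completed) tensor product of $X$ with itself, with $X^{\otimes 0}=A$, where $A$ is the identity correspondence over itself: the actions are multiplication and $\langle a,b\rangle=a^*b$. Two $C^*$-correspondences over $A$ are isomorphic if there is a bijection between them that preserves the left action of $A$ and the $A$-valued inner product. We say $X$ is nonperiodic if, for all integers $n\ge 0$, $X^{\otimes n}\cong A$ as $C^*$-correspondences implies $n=0$. A simple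 cycle of length $n\ge 1$ is a graph with $n$ distinct vertices $v_1,\dots,v_n$ and exactly $n$ edges $e_1,\dots,e_n$, where $s(e_i)=v_i$, $r(e_i)=v_{i+1}$ for $i<n$, and $r(e_n)=v_1$. **Proposition.** Let $E$ be a directed graph with finitely many vertices, no sinks and no sources ($E$ may have infinitely many edges). Then the following are equivalent: 1. $X(E)$ is nonperiodic. 2. $E$ is not a disjoint union of simple cycles. (The empty graph counts as an empty disjoint union.) -/

import Mathlib

open scoped ComplexConjugate TensorProduct ZeroAtInfty

universe u

/-- A `C*`-correspondence over a (not necessarily unital) `C*`-algebra `A`: a right Hilbert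
`A`-module, with `A`-valued inner product conjugate-linear in the first variable and complete in the
norm `‖x‖ = ‖⟨x, x⟩‖ ^ (1/2)`, together with a `*`-homomorphism `left` from `A` to the adjointable
operators: the adjoint of `left a` is `left (star a)`. The right action is `x · a = right a x`.
(`CStarModule` in Mathlib is the left-handed notion, with `⟨x, a • y⟩ = a * ⟨x, y⟩`.) -/
structure CStarCorrespondence (A : Type u) [NonUnitalCStarAlgebra A] where
  carrier : Type u
  [normedAddCommGroup : NormedAddCommGroup carrier]
  [normedSpace : NormedSpace ℂ carrier]
  [completeSpace : CompleteSpace carrier]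
  inner : carrier →ₗ⋆[ℂ] carrier →ₗ[ℂ] A
  right : A →ₗ[ℂ] carrier →L[ℂ] carrier
  left : A →ₙₐ[ℂ] carrier →L[ℂ] carrier
  right_mul : ∀ a b x, right (a * b) x = right b (right a x)
  inner_right : ∀ a x y, inner x (right a y) = inner x y * a
  star_inner : ∀ x y, star (inner x y) = inner y x
  inner_self_nonneg : ∀ x, ∃ b, inner x x = star b * b
  norm_sq_eq : ∀ x, ‖x‖ ^ 2 = ‖inner x x‖
  inner_left : ∀ a x y, inner (left a x) y = inner x (left (star a) y)

attribute [instance] CStarCorrespondence.normedAddCommGroup CStarCorrespondence.normedSpace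
  CStarCorrespondence.completeSpace

/-- The data of a `C*`-correspondence, without definiteness and completeness of the norm. -/
structure PreCorrespondence (A : Type u) [NonUnitalCStarAlgebra A] where
  carrier : Type u
  [addCommGroup : AddCommGroup carrier]
  [module : Module ℂ carrier]
  inner : carrier →ₗ⋆[ℂ] carrier →ₗ[ℂ] A
  right : A →ₗ[ℂ] Module.End ℂ carrier
  left : A →ₙₐ[ℂ] Module.End ℂ carrier
  right_mul : ∀ a b x, right (a * b) x = right b (right a x)
  inner_right : ∀ a x y, inner x (right a y) = inner x y * a
  star_inner : ∀ x y, star (inner x y) = inner y x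
  inner_self_nonneg : ∀ x, ∃ b, inner x x = star b * b
  inner_left : ∀ a x y, inner (left a x) y = inner x (left (star a) y)

attribute [instance] PreCorrespondence.addCommGroup PreCorrespondence.module

namespace PreCorrespondence

variable {A : Type u} [NonUnitalCStarAlgebra A] (P : PreCorrespondence A)

theorem inner_right_left (a : A) (x y : P.carrier) :
    P.inner (P.right a x) y = star a * P.inner x y := by
  rw [← P.star_inner, P.inner_right, star_mul, P.star_inner]

theorem norm_inner_sq_le (x y : P.carrier) :
    ‖P.inner x y‖ ^ 2 ≤ ‖P.inner x x‖ * ‖P.inner y y‖ := by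
  let _ : PartialOrder A := CStarAlgebra.spectralOrder A
  have _ : StarOrderedRing A := CStarAlgebra.spectralOrderedRing A
  have key : ∀ K : ℝ, ‖P.inner x x‖ < K → ‖P.inner x y‖ ^ 2 ≤ K * ‖P.inner y y‖ := by
    intro K hK
    have hK0 : 0 < K := lt_of_le_of_lt (norm_nonneg _) hK
    set a := P.inner x y with ha
    have hxx : 0 ≤ P.inner x x :=
      CStarAlgebra.nonneg_iff_eq_star_mul_self.2 (P.inner_self_nonneg x)
    have h0 : 0 ≤ P.inner (P.right a x - (K : ℂ) • y) (P.right a x - (K : ℂ) • y) :=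
      CStarAlgebra.nonneg_iff_eq_star_mul_self.2 (P.inner_self_nonneg _)
    have h1 : P.inner (P.right a x - (K : ℂ) • y) (P.right a x - (K : ℂ) • y)
        = star a * P.inner x x * a - (2 * K) • (star a * a) + (K ^ 2) • P.inner y y := by
      have hyx : P.inner y x = star a := by rw [ha, P.star_inner]
      have hc : ∀ (r : ℝ) (z : A), r • z = (r : ℂ) • z := fun r z => rfl
      simp only [map_sub, LinearMap.sub_apply, LinearMap.map_smulₛₗ, LinearMap.smul_apply,
        P.inner_right, P.inner_right_left, map_smul, hyx, ← ha, Complex.conj_ofReal, hc]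
      push_cast
      module
    have h2 : star a * P.inner x x * a ≤ K • (star a * a) :=
      (CStarAlgebra.star_left_conjugate_le_norm_smul).trans
        (by
          have := star_mul_self_nonneg a
          gcongr)
    have h3 : K • (star a * a) ≤ (K ^ 2) • P.inner y y := by
      have h4 : 0 ≤ K • (star a * a) - (2 * K) • (star a * a) + (K ^ 2) • P.inner y y := by
        rw [h1] at h0
        exact h0.trans (by gcongr)
      have h5 : K • (star a * a) - (2 * K) • (star a * a) + (K ^ 2) • P.inner y y
        = (K ^ 2) • P.inner y y - K • (star a * a) := by module
      rw [h5] at h4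
      exact sub_nonneg.1 h4
    have h6 := CStarAlgebra.norm_le_norm_of_nonneg_of_le
      (smul_nonneg hK0.le (star_mul_self_nonneg a)) h3
    rw [norm_smul, norm_smul, CStarRing.norm_star_mul_self, Real.norm_of_nonneg hK0.le,
      Real.norm_of_nonneg (by positivity)] at h6
    have : K * (‖a‖ ^ 2) ≤ K * (K * ‖P.inner y y‖) := by nlinarith
    exact le_of_mul_le_mul_left this hK0
  have hc : Filter.Tendsto (fun K : ℝ => K * ‖P.inner y y‖)
      (nhdsWithin ‖P.inner x x‖ (Set.Ioi ‖P.inner x x‖)) (nhds (‖P.inner x x‖ * ‖P.inner y y‖)) :=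
    ((continuous_id.mul continuous_const).tendsto _).mono_left nhdsWithin_le_nhds
  exact ge_of_tendsto hc (Filter.eventually_of_mem self_mem_nhdsWithin key)

theorem seminormCore :
    let _ : Norm P.carrier := ⟨fun x => √‖P.inner x x‖⟩
    SeminormedSpace.Core ℂ P.carrier := by
  let _ : Norm P.carrier := ⟨fun x => √‖P.inner x x‖⟩
  have hn : ∀ x : P.carrier, ‖x‖ = √‖P.inner x x‖ := fun _ => rfl
  refine ⟨fun x => Real.sqrt_nonneg _, fun c x => ?_, fun x y => ?_⟩
  · rw [hn, hn]
    simp only [LinearMap.map_smulₛₗ, LinearMap.smul_apply, RingHom.id_apply, norm_smul,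
      RCLike.norm_conj, ← mul_assoc]
    rw [Real.sqrt_mul (by positivity), Real.sqrt_mul_self (norm_nonneg _)]
  · have hxy : ∀ x y : P.carrier, ‖P.inner x y‖ ≤ ‖x‖ * ‖y‖ := fun x y => by
      rw [hn, hn, ← Real.sqrt_mul (norm_nonneg _)]
      exact Real.le_sqrt_of_sq_le (P.norm_inner_sq_le x y)
    rw [hn (x + y)]
    refine Real.sqrt_le_iff.2 ⟨add_nonneg (Real.sqrt_nonneg _) (Real.sqrt_nonneg _), ?_⟩
    have hsq : ∀ x : P.carrier, ‖P.inner x x‖ = ‖x‖ ^ 2 := fun x => by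
      rw [hn, Real.sq_sqrt (norm_nonneg _)]
    calc ‖P.inner (x + y) (x + y)‖
        = ‖P.inner x x + P.inner x y + (P.inner y x + P.inner y y)‖ := by
          simp only [map_add, LinearMap.add_apply]
          congr 1; abel
      _ ≤ ‖P.inner x x‖ + ‖P.inner x y‖ + (‖P.inner y x‖ + ‖P.inner y y‖) :=
          (norm_add_le _ _).trans (add_le_add (norm_add_le _ _) (norm_add_le _ _))
      _ ≤ ‖x‖ ^ 2 + ‖x‖ * ‖y‖ + (‖y‖ * ‖x‖ + ‖y‖ ^ 2) := by
          rw [hsq, hsq]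
          gcongr <;> exact hxy _ _
      _ = (‖x‖ + ‖y‖) ^ 2 := by ring

/-- The seminorm `‖⟨x, x⟩‖ ^ (1/2)`. -/
noncomputable instance : SeminormedAddCommGroup P.carrier :=
  letI : Norm P.carrier := ⟨fun x => √‖P.inner x x‖⟩
  SeminormedAddCommGroup.ofCore P.seminormCore

noncomputable instance : NormedSpace ℂ P.carrier :=
  letI : Norm P.carrier := ⟨fun x => √‖P.inner x x‖⟩
  { norm_smul_le := fun c x => (P.seminormCore.norm_smul c x).le }

theorem norm_def (x : P.carrier) : ‖x‖ = √‖P.inner x x‖ := rfl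

theorem norm_sq (x : P.carrier) : ‖x‖ ^ 2 = ‖P.inner x x‖ := by
  rw [norm_def, Real.sq_sqrt (norm_nonneg _)]

theorem norm_inner_le (x y : P.carrier) : ‖P.inner x y‖ ≤ ‖x‖ * ‖y‖ := by
  rw [norm_def, norm_def, ← Real.sqrt_mul (norm_nonneg _)]
  exact Real.le_sqrt_of_sq_le (P.norm_inner_sq_le x y)

theorem norm_right_le (a : A) (x : P.carrier) : ‖P.right a x‖ ≤ ‖a‖ * ‖x‖ := by
  refine le_of_sq_le_sq ?_ (by positivity)
  rw [norm_sq, P.inner_right, P.inner_right_left, mul_pow, norm_sq]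
  calc ‖star a * P.inner x x * a‖ ≤ ‖star a‖ * ‖P.inner x x‖ * ‖a‖ :=
        (norm_mul_le _ _).trans (by gcongr; exact norm_mul_le _ _)
    _ = ‖a‖ ^ 2 * ‖P.inner x x‖ := by rw [norm_star]; ring

/-- In the unitization, `‖h‖ - h = c* c` for a positive `h`; here `c = l + b`. -/
theorem exists_norm_sub (a : A) : ∃ (l : ℂ) (b : A), conj l * l = (‖star a * a‖ : ℂ) ∧
    conj l • b + l • star b + star b * b = - (star a * a) := by
  have ht : IsSelfAdjoint (star a * a) := IsSelfAdjoint.star_mul_self a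
  generalize star a * a = p at ht
  let _ : PartialOrder (Unitization ℂ A) := CStarAlgebra.spectralOrder _
  have _ : StarOrderedRing (Unitization ℂ A) := CStarAlgebra.spectralOrderedRing _
  have hs : IsSelfAdjoint (p : Unitization ℂ A) := by
    rw [IsSelfAdjoint, ← Unitization.inr_star, ht.star_eq]
  have h1 : 0 ≤ algebraMap ℝ (Unitization ℂ A) ‖(p : Unitization ℂ A)‖ - (p : Unitization ℂ A) :=
    sub_nonneg.2 hs.le_algebraMap_norm_self
  obtain ⟨c, hc⟩ := CStarAlgebra.nonneg_iff_eq_star_mul_self.1 h1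
  have h2 : algebraMap ℝ (Unitization ℂ A) ‖(p : Unitization ℂ A)‖
      = Unitization.inl ((‖p‖ : ℝ) : ℂ) := by
    rw [Unitization.norm_inr]; rfl
  rw [h2, sub_eq_add_neg, ← Unitization.inr_neg] at hc
  refine ⟨c.fst, c.snd, ?_, ?_⟩
  · simpa using (Unitization.ext_iff.1 hc).1.symm
  · simpa using (Unitization.ext_iff.1 hc).2.symm

theorem norm_left_le (a : A) (x : P.carrier) : ‖P.left a x‖ ≤ ‖a‖ * ‖x‖ := by
  let _ : PartialOrder A := CStarAlgebra.spectralOrder A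
  have _ : StarOrderedRing A := CStarAlgebra.spectralOrderedRing A
  obtain ⟨l, b, h1, h2⟩ := exists_norm_sub a
  have h0 : 0 ≤ P.inner (l • x + P.left b x) (l • x + P.left b x) :=
    CStarAlgebra.nonneg_iff_eq_star_mul_self.2 (P.inner_self_nonneg _)
  have h3 : P.inner (l • x + P.left b x) (l • x + P.left b x)
      = (‖star a * a‖ : ℂ) • P.inner x x - P.inner (P.left a x) (P.left a x) := by
    have h4 : P.inner x (P.left (conj l • b + l • star b + star b * b) x)
      = - P.inner (P.left a x) (P.left a x) := by
      rw [h2, P.inner_left, map_neg, map_mul]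
      simp
    rw [← h1, sub_eq_add_neg, ← h4]
    simp only [map_add, LinearMap.add_apply, LinearMap.map_smulₛₗ, LinearMap.smul_apply,
      map_smul, P.inner_left, map_mul, Module.End.mul_apply]
    module
  rw [h3] at h0
  have h5 := CStarAlgebra.norm_le_norm_of_nonneg_of_le
    (CStarAlgebra.nonneg_iff_eq_star_mul_self.2 (P.inner_self_nonneg _)) (sub_nonneg.1 h0)
  refine le_of_sq_le_sq ?_ (by positivity)
  rw [norm_sq, mul_pow, norm_sq]
  rw [norm_smul, CStarRing.norm_star_mul_self] at h5
  simpa [sq] using h5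

open UniformSpace in
/-- The extension of the inner product to the Hausdorff completion. -/
noncomputable def completionInner : Completion P.carrier → Completion P.carrier → A :=
  Function.curry ((Completion.isDenseInducing_coe.prodMap Completion.isDenseInducing_coe).extend
    (Function.uncurry fun x y : P.carrier => P.inner x y))

theorem continuous_inner :
    Continuous (Function.uncurry fun x y : P.carrier => P.inner x y) :=
  let L := LinearMap.mkContinuous₂ P.inner 1 (fun x y => by simpa using P.norm_inner_le x y)
  (L.continuous.comp continuous_fst).clm_apply continuous_snd

open UniformSpace in
@[simp]
theorem completionInner_coe (x y : P.carrier) :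
    P.completionInner (x : Completion P.carrier) (y : Completion P.carrier) = P.inner x y :=
  (Completion.isDenseInducing_coe.prodMap Completion.isDenseInducing_coe).extend_eq
    P.continuous_inner (x, y)

open UniformSpace in
theorem continuous_completionInner : Continuous (Function.uncurry P.completionInner) := by
  let inner' : P.carrier →+ P.carrier →+ A :=
    { toFun := fun x => (P.inner x).toAddMonoidHom
      map_zero' := by ext x; simp
      map_add' := fun x y => by ext z; simp }
  have h : Continuous fun p : P.carrier × P.carrier => inner' p.1 p.2 := P.continuous_inner
  exact (Completion.isDenseInducing_toCompl P.carrier).extend_Z_bilin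
    (Completion.isDenseInducing_toCompl P.carrier) h

theorem continuous_completionInner_comp {α : Type*} [TopologicalSpace α]
    {f g : α → UniformSpace.Completion P.carrier} (hf : Continuous f) (hg : Continuous g) :
    Continuous fun x => P.completionInner (f x) (g x) :=
  P.continuous_completionInner.comp (hf.prodMk hg)

/-- The right action by `a` as a bounded operator. -/
noncomputable def rightCLM (a : A) : P.carrier →L[ℂ] P.carrier :=
  (P.right a).mkContinuous ‖a‖ (P.norm_right_le a)

/-- The left action of `a` as a bounded operator. -/
noncomputable def leftCLM (a : A) : P.carrier →L[ℂ] P.carrier :=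
  (P.left a).mkContinuous ‖a‖ (P.norm_left_le a)

@[simp] theorem rightCLM_apply (a : A) (x : P.carrier) : P.rightCLM a x = P.right a x := rfl

@[simp] theorem leftCLM_apply (a : A) (x : P.carrier) : P.leftCLM a x = P.left a x := rfl

open UniformSpace in
theorem completion_clm_ext {f g : Completion P.carrier →L[ℂ] Completion P.carrier}
    (h : ∀ x : P.carrier, f (x : Completion P.carrier) = g (x : Completion P.carrier)) : f = g :=
  ContinuousLinearMap.coeFn_injective (Completion.ext f.continuous g.continuous h)

open UniformSpace in
theorem completionInner_add_right (x y z : Completion P.carrier) :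
    P.completionInner x (y + z) = P.completionInner x y + P.completionInner x z :=
  Completion.induction_on₃ x y z
    (isClosed_eq (P.continuous_completionInner_comp continuous_fst
        ((continuous_fst.comp continuous_snd).add (continuous_snd.comp continuous_snd)))
      ((P.continuous_completionInner_comp continuous_fst (continuous_fst.comp continuous_snd)).add
        (P.continuous_completionInner_comp continuous_fst (continuous_snd.comp continuous_snd))))
    fun a b c => by
      rw [← Completion.coe_add]
      simp only [completionInner_coe, map_add]

open UniformSpace in
theorem completionInner_smul_right (c : ℂ) (x y : Completion P.carrier) :
    P.completionInner x (c • y) = c • P.completionInner x y :=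
  Completion.induction_on₂ x y
    (isClosed_eq (P.continuous_completionInner_comp continuous_fst (continuous_snd.const_smul c))
      ((P.continuous_completionInner_comp continuous_fst continuous_snd).const_smul c))
    fun a b => by
      rw [← Completion.coe_smul]
      simp only [completionInner_coe, map_smul]

open UniformSpace in
theorem star_completionInner (x y : Completion P.carrier) :
    star (P.completionInner x y) = P.completionInner y x :=
  Completion.induction_on₂ x y
    (isClosed_eq (P.continuous_completionInner_comp continuous_fst continuous_snd).star
      (P.continuous_completionInner_comp continuous_snd continuous_fst))
    fun a b => by simp only [completionInner_coe, P.star_inner]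

open UniformSpace in
/-- The inner product of the completion, as a sesquilinear map. -/
noncomputable def completionInnerₛₗ :
    Completion P.carrier →ₗ⋆[ℂ] Completion P.carrier →ₗ[ℂ] A :=
  LinearMap.mk₂'ₛₗ (starRingEnd ℂ) (RingHom.id ℂ) P.completionInner
    (fun x y z => by
      rw [← star_completionInner, completionInner_add_right, star_add, star_completionInner,
        star_completionInner])
    (fun c x y => by
      rw [← star_completionInner, completionInner_smul_right, star_smul, star_completionInner]
      rfl)
    (fun x y z => P.completionInner_add_right x y z)
    (fun c x y => P.completionInner_smul_right c x y)

open UniformSpace in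
@[simp]
theorem completionInnerₛₗ_coe (x y : P.carrier) :
    P.completionInnerₛₗ (x : Completion P.carrier) (y : Completion P.carrier) = P.inner x y :=
  P.completionInner_coe x y

/-- The right action on the completion. -/
noncomputable def completionRight :
    A →ₗ[ℂ] UniformSpace.Completion P.carrier →L[ℂ] UniformSpace.Completion P.carrier where
  toFun a := (P.rightCLM a).completion
  map_add' a b := P.completion_clm_ext fun x => by simp [← UniformSpace.Completion.coe_add]
  map_smul' c a := P.completion_clm_ext fun x => by simp [← UniformSpace.Completion.coe_smul]

/-- The left action on the completion. -/
noncomputable def completionLeft :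
    A →ₙₐ[ℂ] UniformSpace.Completion P.carrier →L[ℂ] UniformSpace.Completion P.carrier where
  toFun a := (P.leftCLM a).completion
  map_zero' := P.completion_clm_ext fun x => by simp [UniformSpace.Completion.coe_zero]
  map_add' a b := P.completion_clm_ext fun x => by simp [← UniformSpace.Completion.coe_add]
  map_smul' c a := P.completion_clm_ext fun x => by simp [← UniformSpace.Completion.coe_smul]
  map_mul' a b := P.completion_clm_ext fun x => by simp

open UniformSpace in
@[simp]
theorem completionRight_coe (a : A) (x : P.carrier) :
    P.completionRight a (x : Completion P.carrier) = (P.right a x : P.carrier) := by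
  simp [completionRight]

open UniformSpace in
@[simp]
theorem completionLeft_coe (a : A) (x : P.carrier) :
    P.completionLeft a (x : Completion P.carrier) = (P.left a x : P.carrier) := by
  simp [completionLeft]

open UniformSpace in
/-- The `C*`-correspondence obtained by dividing out the vectors of length zero and completing. -/
noncomputable def completion : CStarCorrespondence A where
  carrier := Completion P.carrier
  inner := P.completionInnerₛₗ
  right := P.completionRight
  left := P.completionLeft
  right_mul a b x := by
    refine Completion.induction_on x (isClosed_eq (ContinuousLinearMap.continuous _)
      ((ContinuousLinearMap.continuous _).comp (ContinuousLinearMap.continuous _))) fun x => ?_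
    simp [P.right_mul]
  inner_right a x y := Completion.induction_on₂ x y
      (isClosed_eq (P.continuous_completionInner_comp continuous_fst
          ((ContinuousLinearMap.continuous _).comp continuous_snd))
        ((P.continuous_completionInner_comp continuous_fst continuous_snd).mul_const _))
      fun x y => by simp [P.inner_right]
  star_inner x y := P.star_completionInner x y
  inner_self_nonneg x := by
    let _ : PartialOrder A := CStarAlgebra.spectralOrder A
    have _ : StarOrderedRing A := CStarAlgebra.spectralOrderedRing A
    rw [← CStarAlgebra.nonneg_iff_eq_star_mul_self]
    refine Completion.induction_on x (isClosed_le continuous_const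
      (P.continuous_completionInner_comp continuous_id continuous_id)) fun x => ?_
    simpa using
      CStarAlgebra.nonneg_iff_eq_star_mul_self.2 (P.inner_self_nonneg x)
  norm_sq_eq x := Completion.induction_on x
      (isClosed_eq (continuous_norm.pow 2)
        (P.continuous_completionInner_comp continuous_id continuous_id).norm)
      fun x => by simp [P.norm_sq]
  inner_left a x y := Completion.induction_on₂ x y
      (isClosed_eq (P.continuous_completionInner_comp
          ((ContinuousLinearMap.continuous _).comp continuous_fst) continuous_snd)
        (P.continuous_completionInner_comp continuous_fst
          ((ContinuousLinearMap.continuous _).comp continuous_snd)))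
      fun x y => by simp [P.inner_left]

end PreCorrespondence

namespace CStarCorrespondence

section tensor

variable {A : Type u} [NonUnitalCStarAlgebra A]

theorem inner_right_left (X : CStarCorrespondence A) (a : A) (x y : X.carrier) :
    X.inner (X.right a x) y = star a * X.inner x y := by
  rw [← X.star_inner, X.inner_right, star_mul, X.star_inner]

theorem nonneg_iff_exists {B : Type*} [NonUnitalCStarAlgebra B] [PartialOrder B]
    [StarOrderedRing B] {b : B} : 0 ≤ b ↔ ∃ c, b = star c * c :=
  CStarAlgebra.nonneg_iff_eq_star_mul_self

theorem exists_negPart {B : Type*} [NonUnitalCStarAlgebra B] [PartialOrder B] [StarOrderedRing B]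
    (M : B) (hM : IsSelfAdjoint M) :
    ∃ d : B, 0 ≤ d ∧ star d * (M * d) = -(d * d * d) ∧ (d = 0 → 0 ≤ M) := by
  have hd0 : 0 ≤ M⁻ := CFC.negPart_nonneg M
  refine ⟨M⁻, hd0, ?_, (CFC.negPart_eq_zero_iff M hM).1⟩
  have h1 : M * M⁻ = -(M⁻ * M⁻) := by
    nth_rewrite 1 [← CFC.posPart_sub_negPart M hM]
    rw [sub_mul, CFC.posPart_mul_negPart, zero_sub]
  rw [h1, (IsSelfAdjoint.of_nonneg hd0).star_eq, mul_neg, mul_assoc]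

/-- A Gram matrix in a Hilbert module is positive: it is of the form `Q* Q`. -/
theorem exists_gram_eq (X : CStarCorrespondence A) {n : ℕ} (x : Fin n → X.carrier) :
    ∃ Q : Fin n → Fin n → A, ∀ i j, X.inner (x i) (x j) = ∑ k, star (Q k i) * Q k j := by
  let _ : PartialOrder A := CStarAlgebra.spectralOrder A
  have _ : StarOrderedRing A := CStarAlgebra.spectralOrderedRing A
  let M : CStarMatrix (Fin n) (Fin n) A := CStarMatrix.ofMatrix fun i j => X.inner (x i) (x j)
  have hM : ∀ i j, M i j = X.inner (x i) (x j) := fun _ _ => rfl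
  have hMs : IsSelfAdjoint M := by
    ext i j
    rw [CStarMatrix.star_apply, hM, hM, X.star_inner]
  obtain ⟨d, hd0, hMd, hd⟩ := exists_negPart M hMs
  have hds : star d = d := (IsSelfAdjoint.of_nonneg hd0).star_eq
  have hdiag : ∀ j, 0 ≤ (star d * (M * d)) j j := by
    intro j
    have : (star d * (M * d)) j j
        = X.inner (∑ i, X.right (d i j) (x i)) (∑ i, X.right (d i j) (x i)) := by
      simp only [CStarMatrix.mul_apply, CStarMatrix.star_apply, map_sum, LinearMap.sum_apply,
        inner_right, inner_right_left, hM, Finset.mul_sum, mul_assoc]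
      exact Finset.sum_comm
    rw [this]
    exact nonneg_iff_exists.2 (X.inner_self_nonneg _)
  have hd3 : 0 ≤ d * d * d := by
    have := star_left_conjugate_nonneg hd0 d
    rwa [hds] at this
  obtain ⟨e, he⟩ := nonneg_iff_exists.1 hd3
  have he0 : e = 0 := by
    ext k j
    have h1 : (star e * e) j j = ∑ k, star (e k j) * e k j := by
      simp only [CStarMatrix.mul_apply, CStarMatrix.star_apply]
    have h2 : ∑ k, star (e k j) * e k j = 0 := by
      refine le_antisymm ?_ (Finset.sum_nonneg fun k _ => star_mul_self_nonneg _)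
      have := hdiag j
      rw [hMd, he, CStarMatrix.neg_apply, h1] at this
      exact neg_nonneg.1 this
    have h3 := (Finset.sum_eq_zero_iff_of_nonneg
      (fun k _ => star_mul_self_nonneg (e k j))).1 h2 k (Finset.mem_univ _)
    exact CStarRing.star_mul_self_eq_zero_iff _ |>.1 h3
  have hd30 : d * d * d = 0 := by rw [he, he0, mul_zero]
  have hdd : d * d = 0 := by
    have : star (d * d) * (d * d) = 0 := by
      rw [star_mul, hds, ← mul_assoc, hd30, zero_mul]
    exact CStarRing.star_mul_self_eq_zero_iff _ |>.1 this
  have hd00 : d = 0 := by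
    have : star d * d = 0 := by rw [hds, hdd]
    exact CStarRing.star_mul_self_eq_zero_iff _ |>.1 this
  have hM0 : 0 ≤ M := hd hd00
  obtain ⟨Q, hQ⟩ := nonneg_iff_exists.1 hM0
  refine ⟨fun k i => Q k i, fun i j => ?_⟩
  rw [← hM, hQ, CStarMatrix.mul_apply]
  simp only [CStarMatrix.star_apply]

variable (X Y : CStarCorrespondence A)

/-- The `A`-valued form on the algebraic tensor product with
`⟨x ⊗ y, x' ⊗ y'⟩ = ⟨y, ⟨x, x'⟩ · y'⟩`. -/
noncomputable def tensorInner :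
    X.carrier ⊗[ℂ] Y.carrier →ₗ⋆[ℂ] X.carrier ⊗[ℂ] Y.carrier →ₗ[ℂ] A :=
  TensorProduct.lift <| LinearMap.mk₂'ₛₗ (starRingEnd ℂ) (starRingEnd ℂ)
    (fun x y => TensorProduct.lift <| LinearMap.mk₂ ℂ
      (fun x' y' => Y.inner y (Y.left (X.inner x x') y'))
      (fun x₁ x₂ y' => by simp) (fun c x' y' => by simp)
      (fun x' y₁ y₂ => by simp) (fun c x' y' => by simp))
    (fun x₁ x₂ y => by ext x' y'; simp)
    (fun c x y => by ext x' y'; simp)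
    (fun x y₁ y₂ => by ext x' y'; simp)
    (fun c x y => by ext x' y'; simp)

@[simp]
theorem tensorInner_tmul (x x' : X.carrier) (y y' : Y.carrier) :
    tensorInner X Y (x ⊗ₜ y) (x' ⊗ₜ y') = Y.inner y (Y.left (X.inner x x') y') := rfl

/-- The right action `(x ⊗ y) · a = x ⊗ (y · a)` on the algebraic tensor product. -/
noncomputable def tensorRight : A →ₗ[ℂ] Module.End ℂ (X.carrier ⊗[ℂ] Y.carrier) where
  toFun a := LinearMap.lTensor X.carrier (Y.right a : Y.carrier →ₗ[ℂ] Y.carrier)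
  map_add' a b := by ext x y; simp
  map_smul' c a := by ext x y; simp

/-- The left action `a · (x ⊗ y) = (a · x) ⊗ y` on the algebraic tensor product. -/
noncomputable def tensorLeft : A →ₙₐ[ℂ] Module.End ℂ (X.carrier ⊗[ℂ] Y.carrier) where
  toFun a := LinearMap.rTensor Y.carrier (X.left a : X.carrier →ₗ[ℂ] X.carrier)
  map_zero' := by ext x y; simp
  map_add' a b := by ext x y; simp
  map_smul' c a := by ext x y; simp [TensorProduct.smul_tmul']
  map_mul' a b := by ext x y; simp

@[simp]
theorem tensorRight_tmul (a : A) (x : X.carrier) (y : Y.carrier) :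
    tensorRight X Y a (x ⊗ₜ y) = x ⊗ₜ Y.right a y := rfl

@[simp]
theorem tensorLeft_tmul (a : A) (x : X.carrier) (y : Y.carrier) :
    tensorLeft X Y a (x ⊗ₜ y) = X.left a x ⊗ₜ y := rfl

/-- The algebraic tensor product with its `A`-valued form and actions. The `A`-balancing relations
`x · a ⊗ y = x ⊗ a · y` hold up to vectors of length zero. -/
noncomputable def preTensor : PreCorrespondence A where
  carrier := X.carrier ⊗[ℂ] Y.carrier
  inner := tensorInner X Y
  right := tensorRight X Y
  left := tensorLeft X Y
  right_mul a b z := by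
    induction z with
    | zero => simp
    | tmul x y => simp [Y.right_mul]
    | add z w hz hw => simp only [map_add, hz, hw]
  inner_right a z w := by
    induction z with
    | zero => simp
    | add z z' hz hz' => simp only [map_add, LinearMap.add_apply, hz, hz', add_mul]
    | tmul x y =>
      induction w with
      | zero => simp
      | add w w' hw hw' => simp only [map_add, hw, hw', add_mul]
      | tmul x' y' =>
        rw [tensorRight_tmul, tensorInner_tmul, tensorInner_tmul,
          ← star_star (X.inner x x'), ← Y.inner_left, Y.inner_right, Y.inner_left]
  star_inner z w := by
    induction z with
    | zero => simp
    | add z z' hz hz' => simp only [map_add, LinearMap.add_apply, hz, hz', star_add]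
    | tmul x y =>
      induction w with
      | zero => simp
      | add w w' hw hw' => simp only [map_add, LinearMap.add_apply, hw, hw', star_add]
      | tmul x' y' => simp [Y.star_inner, Y.inner_left, X.star_inner]
  inner_self_nonneg z := by
    let _ : PartialOrder A := CStarAlgebra.spectralOrder A
    have _ : StarOrderedRing A := CStarAlgebra.spectralOrderedRing A
    rw [← nonneg_iff_exists]
    obtain ⟨n, x, y, rfl⟩ := TensorProduct.exists_sum_tmul_eq z
    obtain ⟨Q, hQ⟩ := X.exists_gram_eq x
    have h : tensorInner X Y (∑ i, x i ⊗ₜ y i) (∑ i, x i ⊗ₜ y i)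
        = ∑ k, Y.inner (∑ i, Y.left (Q k i) (y i)) (∑ i, Y.left (Q k i) (y i)) := by
      simp only [map_sum, LinearMap.sum_apply, tensorInner_tmul, hQ, map_mul,
        sum_apply, mul_apply_eq_comp, Y.inner_left]
      exact (Finset.sum_congr rfl fun j _ => Finset.sum_comm).trans Finset.sum_comm
    rw [h]
    exact Finset.sum_nonneg fun k _ =>
      nonneg_iff_exists.2 (Y.inner_self_nonneg _)
  inner_left a z w := by
    induction z with
    | zero => simp
    | add z z' hz hz' => simp only [map_add, LinearMap.add_apply, hz, hz']
    | tmul x y =>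
      induction w with
      | zero => simp
      | add w w' hw hw' => simp only [map_add, hw, hw']
      | tmul x' y' => simp [X.inner_left]

end tensor

end CStarCorrespondence

namespace PreCorrespondence

variable {A : Type u} [NonUnitalCStarAlgebra A]

/-- A definite and complete `PreCorrespondence` is a `C*`-correspondence. -/
noncomputable def toCStarCorrespondence (P : PreCorrespondence A)
    (hdef : ∀ x, P.inner x x = 0 → x = 0) (hcomplete : CompleteSpace P.carrier) :
    CStarCorrespondence A where
  carrier := P.carrier
  normedAddCommGroup := NormedAddCommGroup.ofSeparation fun x hx =>
    hdef x (norm_eq_zero.1 (by rw [← P.norm_sq, hx, sq, mul_zero]))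
  normedSpace := { norm_smul_le := norm_smul_le }
  completeSpace := hcomplete
  inner := P.inner
  right :=
    { toFun := P.rightCLM
      map_add' := fun a b => by ext x; simp
      map_smul' := fun c a => by ext x; simp }
  left :=
    { toFun := P.leftCLM
      map_zero' := by ext x; simp
      map_add' := fun a b => by ext x; simp
      map_smul' := fun c a => by ext x; simp
      map_mul' := fun a b => by ext x; simp }
  right_mul := P.right_mul
  inner_right := P.inner_right
  star_inner := P.star_inner
  inner_self_nonneg := P.inner_self_nonneg
  norm_sq_eq := P.norm_sq
  inner_left := P.inner_left

end PreCorrespondence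

namespace CStarCorrespondence

variable {A : Type u} [NonUnitalCStarAlgebra A]

/-- The (interior, `A`-balanced) tensor product `X ⊗_A Y`: the Hausdorff completion of the algebraic
tensor product for `⟨x ⊗ y, x' ⊗ y'⟩ = ⟨y, ⟨x, x'⟩ · y'⟩`, with `a · (x ⊗ y) = (a · x) ⊗ y` and
`(x ⊗ y) · a = x ⊗ (y · a)`. -/
noncomputable def tensor (X Y : CStarCorrespondence A) : CStarCorrespondence A :=
  (preTensor X Y).completion

/-- The elementary tensor `x ⊗ y` in `X ⊗_A Y`. -/
noncomputable def tmul (X Y : CStarCorrespondence A) (x : X.carrier) (y : Y.carrier) :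
    (X.tensor Y).carrier :=
  UniformSpace.Completion.coe' (α := (preTensor X Y).carrier) (x ⊗ₜ[ℂ] y : X.carrier ⊗[ℂ] Y.carrier)

theorem inner_tmul (X Y : CStarCorrespondence A) (x x' : X.carrier) (y y' : Y.carrier) :
    (X.tensor Y).inner (X.tmul Y x y) (X.tmul Y x' y') = Y.inner y (Y.left (X.inner x x') y') :=
  (preTensor X Y).completionInner_coe _ _

theorem left_tmul (X Y : CStarCorrespondence A) (a : A) (x : X.carrier) (y : Y.carrier) :
    (X.tensor Y).left a (X.tmul Y x y) = X.tmul Y (X.left a x) y :=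
  (preTensor X Y).completionLeft_coe a _

theorem right_tmul (X Y : CStarCorrespondence A) (a : A) (x : X.carrier) (y : Y.carrier) :
    (X.tensor Y).right a (X.tmul Y x y) = X.tmul Y x (Y.right a y) :=
  (preTensor X Y).completionRight_coe a _

variable (A) in
/-- The identity `C*`-correspondence: `A` over itself, with multiplication and
`⟨a, b⟩ = star a * b`. -/
noncomputable def identity : CStarCorrespondence A where
  carrier := A
  inner := LinearMap.mk₂'ₛₗ (starRingEnd ℂ) (RingHom.id ℂ) (fun a b => star a * b)
    (fun a b c => by rw [star_add, add_mul])
    (fun c a b => by rw [star_smul, smul_mul_assoc]; rfl)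
    (fun a b c => mul_add _ _ _)
    (fun c a b => mul_smul_comm _ _ _)
  right := ((ContinuousLinearMap.mul ℂ A).flip : A →ₗ[ℂ] A →L[ℂ] A)
  left := NonUnitalAlgHom.Lmul ℂ A
  right_mul a b x := (mul_assoc x a b).symm
  inner_right a x y := (mul_assoc (star x) y a).symm
  star_inner x y := by simp
  inner_self_nonneg x := ⟨x, rfl⟩
  norm_sq_eq x := by simp [CStarRing.norm_star_mul_self, sq]
  inner_left a x y := by simp [mul_assoc]

/-- Isomorphism of `C*`-correspondences: a bijection preserving the left action and the inner
product; such a map is automatically linear and preserves the right action. -/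
def Isomorphic (X Y : CStarCorrespondence A) : Prop :=
  ∃ Φ : X.carrier → Y.carrier, Function.Bijective Φ ∧
    (∀ a x, Φ (X.left a x) = Y.left a (Φ x)) ∧
    ∀ x x', Y.inner (Φ x) (Φ x') = X.inner x x'

/-- The tensor powers `X^{⊗ n} = X ⊗_A ⋯ ⊗_A X`, with `X^{⊗ 0} = A`. -/
noncomputable def tensorPow (X : CStarCorrespondence A) : ℕ → CStarCorrespondence A
  | 0 => identity A
  | 1 => X
  | n + 2 => X.tensor (X.tensorPow (n + 1))

/-- `X` is nonperiodic if `X^{⊗ n} ≅ A` as `C*`-correspondences only for `n = 0`. -/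
def Nonperiodic (X : CStarCorrespondence A) : Prop :=
  ∀ n : ℕ, Isomorphic (X.tensorPow n) (identity A) → n = 0

end CStarCorrespondence

/-- A directed graph: sets of vertices and edges with source and range maps; loops and multiple
edges are allowed. -/
structure DirectedGraph where
  V : Type u
  E : Type u
  s : E → V
  r : E → V

namespace DirectedGraph

open Filter Topology

/-- No sinks: every vertex emits an edge. -/
def NoSinks (G : DirectedGraph.{u}) : Prop := ∀ v, ∃ e, G.s e = v

/-- No sources: every vertex receives an edge. -/
def NoSources (G : DirectedGraph.{u}) : Prop := ∀ v, ∃ e, G.r e = v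

/-- Isomorphism of directed graphs. -/
def Isomorphic (G H : DirectedGraph.{u}) : Prop :=
  ∃ (φ : G.V ≃ H.V) (ψ : G.E ≃ H.E),
    (∀ e, H.s (ψ e) = φ (G.s e)) ∧ ∀ e, H.r (ψ e) = φ (G.r e)

/-- The graph that is a simple cycle of length `n`: vertices `0, …, n - 1` and edges
`i ⟶ i + 1` modulo `n`. -/
def cycle (n : ℕ) : DirectedGraph.{0} where
  V := Fin n
  E := Fin n
  s := id
  r := finRotate n

/-- The disjoint union of a family of directed graphs. -/
def disjointUnion {ι : Type u} (G : ι → DirectedGraph.{0}) : DirectedGraph.{u} where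
  V := Σ i, (G i).V
  E := Σ i, (G i).E
  s := Sigma.map id fun i => (G i).s
  r := Sigma.map id fun i => (G i).r

/-- `G` is a (possibly empty) disjoint union of simple cycles, of lengths at least one. -/
def IsDisjointUnionOfSimpleCycles (G : DirectedGraph.{u}) : Prop :=
  ∃ (ι : Type u) (n : ι → ℕ), (∀ i, 1 ≤ n i) ∧
    G.Isomorphic (disjointUnion fun i => cycle (n i))

variable (G : DirectedGraph.{u})

/-- The vertex set is given the discrete topology. -/
instance : TopologicalSpace G.V := ⊥

instance : DiscreteTopology G.V := ⟨rfl⟩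

/-- The functions `ξ : E → ℂ` for which `v ↦ ∑_{r e = v} |ξ e| ^ 2` is a convergent sum for every
`v` and lies in `C₀(V)`. -/
def IsVector (ξ : G.E → ℂ) : Prop :=
  (∀ v, Summable fun e : {e // G.r e = v} => ‖ξ e‖ ^ 2) ∧
    Tendsto (fun v => ∑' e : {e // G.r e = v}, ‖ξ e‖ ^ 2) (cocompact G.V) (𝓝 0)

variable {G}

theorem IsVector.memℓp {ξ : G.E → ℂ} (h : G.IsVector ξ) (v : G.V) :
    Memℓp (fun e : {e // G.r e = v} => ξ e) 2 := by
  refine memℓp_gen ?_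
  simpa using h.1 v

/-- The restriction of `ξ` to the edges with range `v`, as an element of `ℓ²`. -/
def IsVector.slice {ξ : G.E → ℂ} (h : G.IsVector ξ) (v : G.V) :
    lp (fun _ : {e // G.r e = v} => ℂ) 2 :=
  ⟨fun e => ξ e, h.memℓp v⟩

theorem IsVector.norm_slice_sq {ξ : G.E → ℂ} (h : G.IsVector ξ) (v : G.V) :
    ‖h.slice v‖ ^ 2 = ∑' e : {e // G.r e = v}, ‖ξ e‖ ^ 2 := by
  have := lp.norm_rpow_eq_tsum (p := 2) (by simp) (h.slice v)
  have h2 : ‖h.slice v‖ ^ 2 = ∑' e, ‖h.slice v e‖ ^ 2 := by simpa using this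
  exact h2

theorem IsVector.tendsto_slice {ξ : G.E → ℂ} (h : G.IsVector ξ) :
    Tendsto (fun v => ‖h.slice v‖) (cocompact G.V) (𝓝 0) := by
  have h1 := h.2.sqrt
  simp only [← h.norm_slice_sq, Real.sqrt_sq (norm_nonneg _), Real.sqrt_zero] at h1
  exact h1

theorem isVector_of_slice {ξ : G.E → ℂ} (x : ∀ v : G.V, lp (fun _ : {e // G.r e = v} => ℂ) 2)
    (hx : ∀ (v : G.V) (e : {e // G.r e = v}), x v e = ξ e)
    (hlim : Tendsto (fun v => ‖x v‖) (cocompact G.V) (𝓝 0)) : G.IsVector ξ := by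
  have h1 : ∀ v, HasSum (fun e : {e // G.r e = v} => ‖ξ e‖ ^ 2) (‖x v‖ ^ 2) := fun v => by
    have := lp.hasSum_norm (p := 2) (by simp) (x v)
    simpa [hx] using this
  refine ⟨fun v => (h1 v).summable, ?_⟩
  have h2 : (fun v => ∑' e : {e // G.r e = v}, ‖ξ e‖ ^ 2) = fun v => ‖x v‖ ^ 2 :=
    funext fun v => (h1 v).tsum_eq
  rw [h2]
  simpa using hlim.pow 2

theorem IsVector.of_norm_le {ξ η : G.E → ℂ} (h : G.IsVector ξ) (c : ℝ)
    (hη : ∀ e, ‖η e‖ ≤ c * ‖ξ e‖) : G.IsVector η := by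
  have h1 : ∀ e, ‖η e‖ ^ 2 ≤ c ^ 2 * ‖ξ e‖ ^ 2 := fun e => by
    rw [← mul_pow]; exact pow_le_pow_left₀ (norm_nonneg _) (hη e) 2
  have h2 : ∀ v, Summable fun e : {e // G.r e = v} => ‖η e‖ ^ 2 := fun v =>
    Summable.of_nonneg_of_le (fun e => by positivity) (fun e => h1 e) ((h.1 v).mul_left _)
  refine ⟨h2, squeeze_zero (fun v => tsum_nonneg fun e => by positivity) (fun v => ?_)
    (by simpa using h.2.const_mul (c ^ 2))⟩
  rw [← tsum_mul_left]
  exact (h2 v).tsum_le_tsum (fun e => h1 e) ((h.1 v).mul_left _)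

theorem IsVector.add {ξ η : G.E → ℂ} (hξ : G.IsVector ξ) (hη : G.IsVector η) :
    G.IsVector (ξ + η) :=
  isVector_of_slice (fun v => hξ.slice v + hη.slice v) (fun _ _ => rfl)
    (squeeze_zero (fun _ => norm_nonneg _) (fun _ => norm_add_le _ _)
      (by simpa using hξ.tendsto_slice.add hη.tendsto_slice))

variable (G)

/-- The vector space underlying the graph correspondence. -/
def vectors : Submodule ℂ (G.E → ℂ) where
  carrier := {ξ | G.IsVector ξ}
  zero_mem' := ⟨fun v => by simp [summable_zero], by simpa using tendsto_const_nhds⟩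
  add_mem' := IsVector.add
  smul_mem' c ξ h := IsVector.of_norm_le h ‖c‖ fun e => by simp

variable {G}

theorem isVector (ξ : G.vectors) : G.IsVector (ξ : G.E → ℂ) := ξ.2

/-- A function satisfying `IsVector`, as an element of `G.vectors`. -/
def mkVector (ξ : G.E → ℂ) (h : G.IsVector ξ) : G.vectors := ⟨ξ, h⟩

/-- The restriction of a vector to the edges with range `v`. -/
def slice (ξ : G.vectors) (v : G.V) : lp (fun _ : {e // G.r e = v} => ℂ) 2 :=
  (isVector ξ).slice v

theorem slice_ext {ξ η : G.vectors} (h : ∀ v, slice ξ v = slice η v) : ξ = η := by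
  ext e
  exact congrArg (fun x : lp (fun _ : {e' // G.r e' = G.r e} => ℂ) 2 => x ⟨e, rfl⟩) (h (G.r e))

theorem slice_zero (v : G.V) : slice (0 : G.vectors) v = 0 := rfl

theorem slice_add (ξ η : G.vectors) (v : G.V) : slice (ξ + η) v = slice ξ v + slice η v := rfl

theorem slice_sub (ξ η : G.vectors) (v : G.V) : slice (ξ - η) v = slice ξ v - slice η v := rfl

theorem slice_smul (c : ℂ) (ξ : G.vectors) (v : G.V) : slice (c • ξ) v = c • slice ξ v := rfl

theorem tendsto_slice (ξ : G.vectors) :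
    Tendsto (fun v => ‖slice ξ v‖) (cocompact G.V) (𝓝 0) :=
  (isVector ξ).tendsto_slice

theorem inner_slice (ξ η : G.vectors) (v : G.V) : inner ℂ (slice ξ v) (slice η v)
    = ∑' e : {e // G.r e = v}, conj (ξ.1 e) * η.1 e := by
  rw [lp.inner_eq_tsum]
  refine tsum_congr fun e => ?_
  rw [RCLike.inner_apply, mul_comm]
  rfl

/-- The inner product `⟨ξ, η⟩(v) = ∑_{r e = v} conj (ξ e) * η e`. -/
noncomputable def innerFun (ξ η : G.vectors) : C₀(G.V, ℂ) where
  toFun v := ∑' e : {e // G.r e = v}, conj (ξ.1 e) * η.1 e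
  continuous_toFun := continuous_of_discreteTopology
  zero_at_infty' := by
    refine squeeze_zero_norm (a := fun v => ‖slice ξ v‖ * ‖slice η v‖) (fun v => ?_) ?_
    · rw [← inner_slice]
      exact norm_inner_le_norm _ _
    · simpa using (tendsto_slice ξ).mul (tendsto_slice η)

theorem innerFun_apply (ξ η : G.vectors) (v : G.V) :
    innerFun ξ η v = ∑' e : {e // G.r e = v}, conj (ξ.1 e) * η.1 e := rfl

theorem innerFun_eq (ξ η : G.vectors) (v : G.V) :
    innerFun ξ η v = inner ℂ (slice ξ v) (slice η v) := (inner_slice ξ η v).symm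

variable (G) in
/-- The inner product as a sesquilinear map. -/
noncomputable def innerₛₗ : G.vectors →ₗ⋆[ℂ] G.vectors →ₗ[ℂ] C₀(G.V, ℂ) :=
  LinearMap.mk₂'ₛₗ (starRingEnd ℂ) (RingHom.id ℂ) innerFun
    (fun ξ η ζ => by
      ext v
      rw [ZeroAtInftyContinuousMap.add_apply]
      simp only [innerFun_eq, slice_add, inner_add_left])
    (fun c ξ η => by
      ext v
      rw [ZeroAtInftyContinuousMap.smul_apply]
      simp only [innerFun_eq, slice_smul, inner_smul_left, smul_eq_mul])
    (fun ξ η ζ => by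
      ext v
      rw [ZeroAtInftyContinuousMap.add_apply]
      simp only [innerFun_eq, slice_add, inner_add_right])
    (fun c ξ η => by
      ext v
      rw [ZeroAtInftyContinuousMap.smul_apply]
      simp only [innerFun_eq, slice_smul, inner_smul_right, smul_eq_mul, RingHom.id_apply])

/-- Pointwise multiplication by a bounded function on the edges. -/
def mulOp (g : G.E → ℂ) (c : ℝ) (hg : ∀ e, ‖g e‖ ≤ c) : Module.End ℂ G.vectors where
  toFun ξ := mkVector (fun e => g e * ξ.1 e) <| (isVector ξ).of_norm_le c fun e => by
    rw [norm_mul]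
    exact mul_le_mul_of_nonneg_right (hg e) (norm_nonneg _)
  map_add' ξ η := by
    ext e
    change g e * (ξ.1 e + η.1 e) = g e * ξ.1 e + g e * η.1 e
    ring
  map_smul' z ξ := by
    ext e
    change g e * (z * ξ.1 e) = z * (g e * ξ.1 e)
    ring

theorem norm_apply_le (a : C₀(G.V, ℂ)) (v : G.V) : ‖a v‖ ≤ ‖a‖ := a.toBCF.norm_coe_le_norm v

variable (G) in
/-- The right action `(ξ · a)(e) = ξ e * a (r e)`. -/
noncomputable def rightAction : C₀(G.V, ℂ) →ₗ[ℂ] Module.End ℂ G.vectors where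
  toFun a := mulOp (fun e => a (G.r e)) ‖a‖ fun _ => norm_apply_le a _
  map_add' a b := LinearMap.ext fun ξ => Subtype.ext (funext fun e =>
    add_mul (a (G.r e)) (b (G.r e)) (ξ.1 e))
  map_smul' c a := LinearMap.ext fun ξ => Subtype.ext (funext fun e =>
    mul_assoc c (a (G.r e)) (ξ.1 e))

variable (G) in
/-- The left action `(a · ξ)(e) = a (s e) * ξ e`. -/
noncomputable def leftAction : C₀(G.V, ℂ) →ₙₐ[ℂ] Module.End ℂ G.vectors where
  toFun a := mulOp (fun e => a (G.s e)) ‖a‖ fun _ => norm_apply_le a _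
  map_zero' := LinearMap.ext fun ξ => Subtype.ext (funext fun e => zero_mul (ξ.1 e))
  map_add' a b := LinearMap.ext fun ξ => Subtype.ext (funext fun e =>
    add_mul (a (G.s e)) (b (G.s e)) (ξ.1 e))
  map_smul' c a := LinearMap.ext fun ξ => Subtype.ext (funext fun e =>
    mul_assoc c (a (G.s e)) (ξ.1 e))
  map_mul' a b := LinearMap.ext fun ξ => Subtype.ext (funext fun e =>
    mul_assoc (a (G.s e)) (b (G.s e)) (ξ.1 e))

theorem rightAction_apply (a : C₀(G.V, ℂ)) (ξ : G.vectors) (e : G.E) :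
    (G.rightAction a ξ).1 e = ξ.1 e * a (G.r e) := mul_comm _ _

theorem leftAction_apply (a : C₀(G.V, ℂ)) (ξ : G.vectors) (e : G.E) :
    (G.leftAction a ξ).1 e = a (G.s e) * ξ.1 e := rfl

theorem inner_rightAction (a : C₀(G.V, ℂ)) (ξ η : G.vectors) :
    innerFun ξ (G.rightAction a η) = innerFun ξ η * a := by
  ext v
  rw [ZeroAtInftyContinuousMap.mul_apply, innerFun_apply, innerFun_apply, ← tsum_mul_right]
  refine tsum_congr fun e => ?_
  rw [rightAction_apply, e.2, mul_assoc]

theorem inner_leftAction (a : C₀(G.V, ℂ)) (ξ η : G.vectors) :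
    innerFun (G.leftAction a ξ) η = innerFun ξ (G.leftAction (star a) η) := by
  ext v
  rw [innerFun_apply, innerFun_apply]
  refine tsum_congr fun e => ?_
  rw [leftAction_apply, leftAction_apply, map_mul, ZeroAtInftyContinuousMap.star_apply]
  change conj (a _) * _ * _ = _ * (conj (a _) * _)
  ring

theorem star_innerFun (ξ η : G.vectors) : star (innerFun ξ η) = innerFun η ξ := by
  ext v
  rw [ZeroAtInftyContinuousMap.star_apply, innerFun_eq, innerFun_eq]
  exact inner_conj_symm _ _

theorem innerFun_self_nonneg (ξ : G.vectors) : ∃ b, innerFun ξ ξ = star b * b := by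
  refine ⟨⟨⟨fun v => (‖slice ξ v‖ : ℂ), continuous_of_discreteTopology⟩, ?_⟩, ?_⟩
  · exact (Complex.continuous_ofReal.tendsto 0).comp (tendsto_slice ξ)
  · ext v
    change innerFun ξ ξ v = conj (‖slice ξ v‖ : ℂ) * (‖slice ξ v‖ : ℂ)
    rw [innerFun_eq, inner_self_eq_norm_sq_to_K, Complex.conj_ofReal]
    exact sq _

variable (G) in
/-- `G.vectors` with its inner product and actions. -/
noncomputable def preCorrespondence : PreCorrespondence C₀(G.V, ℂ) where
  carrier := G.vectors
  inner := G.innerₛₗ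
  right := G.rightAction
  left := G.leftAction
  right_mul a b ξ := Subtype.ext (funext fun e => by
    simp only [rightAction_apply, ZeroAtInftyContinuousMap.mul_apply, mul_assoc])
  inner_right := inner_rightAction
  star_inner := star_innerFun
  inner_self_nonneg := innerFun_self_nonneg
  inner_left := inner_leftAction

theorem innerFun_definite (ξ : G.vectors) (h : innerFun ξ ξ = 0) : ξ = 0 := by
  refine slice_ext fun v => ?_
  have h1 : innerFun ξ ξ v = 0 := by rw [h]; rfl
  rw [innerFun_eq, inner_self_eq_zero] at h1
  rw [h1, slice_zero]

theorem norm_inner_self (ξ : G.vectors) (v : G.V) :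
    ‖inner ℂ (slice ξ v) (slice ξ v)‖ = ‖slice ξ v‖ ^ 2 := by
  rw [inner_self_eq_norm_sq_to_K, norm_pow, RCLike.norm_ofReal, abs_of_nonneg (norm_nonneg _)]

theorem norm_slice_le (ξ : G.vectors) (v : G.V) : ‖slice ξ v‖ ≤ √‖innerFun ξ ξ‖ := by
  refine Real.le_sqrt_of_sq_le ?_
  have h1 := norm_apply_le (innerFun ξ ξ) v
  rwa [innerFun_eq, norm_inner_self] at h1

theorem norm_le_of_slice {ξ : G.vectors} {C : ℝ} (hC : 0 ≤ C) (h : ∀ v, ‖slice ξ v‖ ≤ C) :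
    √‖innerFun ξ ξ‖ ≤ C := by
  refine Real.sqrt_le_iff.2 ⟨hC, ((innerFun ξ ξ).toBCF.norm_le (by positivity)).2 fun v => ?_⟩
  change ‖innerFun ξ ξ v‖ ≤ C ^ 2
  rw [innerFun_eq, norm_inner_self]
  exact pow_le_pow_left₀ (norm_nonneg _) (h v) 2

theorem vectors_complete (u : ℕ → G.vectors)
    (hu : ∀ ε > 0, ∃ N, ∀ m ≥ N, ∀ n ≥ N, √‖innerFun (u m - u n) (u m - u n)‖ < ε) :
    ∃ ζ : G.vectors, ∀ ε > 0, ∃ N, ∀ n ≥ N, √‖innerFun (u n - ζ) (u n - ζ)‖ < ε := by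
  have hv : ∀ v, CauchySeq fun n => slice (u n) v := fun v => by
    refine Metric.cauchySeq_iff.2 fun ε hε => ?_
    obtain ⟨N, hN⟩ := hu ε hε
    refine ⟨N, fun m hm n hn => ?_⟩
    rw [dist_eq_norm, ← slice_sub]
    exact (norm_slice_le _ v).trans_lt (hN m hm n hn)
  choose x hx using fun v => cauchySeq_tendsto_of_complete (hv v)
  have hunif : ∀ ε > 0, ∃ N, ∀ n ≥ N, ∀ v, ‖slice (u n) v - x v‖ ≤ ε := fun ε hε => by
    obtain ⟨N, hN⟩ := hu ε hε
    refine ⟨N, fun n hn v => ?_⟩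
    refine le_of_tendsto ((tendsto_const_nhds.sub (hx v)).norm)
      (eventually_atTop.2 ⟨N, fun m hm => ?_⟩)
    rw [← slice_sub]
    exact (norm_slice_le _ v).trans (hN n hn m hm).le
  have hlim : Tendsto (fun v => ‖x v‖) (cocompact G.V) (𝓝 0) := by
    refine Metric.tendsto_nhds.2 fun ε hε => ?_
    obtain ⟨N, hN⟩ := hunif (ε / 2) (half_pos hε)
    filter_upwards [Metric.tendsto_nhds.1 (tendsto_slice (u N)) (ε / 2) (half_pos hε)] with v hv'
    rw [Real.dist_eq, sub_zero, abs_of_nonneg (norm_nonneg _)] at hv' ⊢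
    have := norm_sub_norm_le (x v) (slice (u N) v)
    rw [norm_sub_rev] at this
    linarith [hN N le_rfl v]
  have hvec : G.IsVector fun e => x (G.r e) ⟨e, rfl⟩ :=
    isVector_of_slice x (by rintro v ⟨e, rfl⟩; rfl) hlim
  have hζ : ∀ v, slice (mkVector _ hvec) v = x v := fun v => by
    ext ⟨e, rfl⟩
    rfl
  refine ⟨mkVector _ hvec, fun ε hε => ?_⟩
  obtain ⟨N, hN⟩ := hunif (ε / 2) (half_pos hε)
  refine ⟨N, fun n hn => (norm_le_of_slice (half_pos hε).le fun v => ?_).trans_lt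
    (half_lt_self hε)⟩
  rw [slice_sub, hζ]
  exact hN n hn v

theorem preCorrespondence_complete : CompleteSpace G.preCorrespondence.carrier := by
  refine Metric.complete_of_cauchySeq_tendsto fun u hu => ?_
  rw [Metric.cauchySeq_iff] at hu
  simp only [dist_eq_norm] at hu
  obtain ⟨ζ, hζ⟩ := vectors_complete u hu
  let ζ' : G.preCorrespondence.carrier := ζ
  refine ⟨ζ', Metric.tendsto_atTop.2 fun ε hε => ?_⟩
  obtain ⟨N, hN⟩ := hζ ε hε
  refine ⟨N, fun n hn => ?_⟩
  rw [dist_eq_norm]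
  exact hN n hn

variable (G) in
/-- The graph correspondence `X(G)` over `C₀(V)`. -/
noncomputable def correspondence : CStarCorrespondence C₀(G.V, ℂ) :=
  G.preCorrespondence.toCStarCorrespondence innerFun_definite preCorrespondence_complete

end DirectedGraph

/-! The correspondence `X(E)` over `A = C₀(V)` is compared with `A` twisted by a permutation of the
vertices.

If `E` is a disjoint union of simple cycles, then `r` and `s` are bijections. The constant function
`1` then generates `X(E)` freely as a right module, and `a · 1 = 1 · (a ∘ τ)` for the permutation `τ
= s ∘ r⁻¹`. Tensoring composes the twists (`IsGenerator.tmul`), so the `n`-th power is `A` twisted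
by `τ ^ n`. Since `V` is finite, `τ` has finite order `n ≥ 1`, and that power is isomorphic to `A`
(`not_nonperiodic_of_bijective`).

Conversely, let `X^{⊗ n} ≅ A` with `n ≥ 1`. The inner product of `A`, evaluated at a vertex `v`, is
`conj (a v) * b v`, so two orthogonal vectors cannot both have length one at `v`. If two distinct
edges ended at `v`, extending both backwards, which is possible without sources, would give two
distinct paths of length `n` ending at `v`, whose indicator vectors are orthogonal with square
length `δ_v` (`exists_isOrthogonalPair`). Hence `r` is injective, and it is surjective as there are
no sources. Without sinks `s ∘ r⁻¹` is a surjection of the finite set `V`, hence a permutation. The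
cycle decomposition of the inverse permutation `r ∘ s⁻¹` exhibits `E` as a disjoint union of simple
cycles. -/

namespace CStarCorrespondence

variable {A : Type u} [NonUnitalCStarAlgebra A]

/-! ### Singly generated correspondences and their tensor powers. -/

theorem eq_zero_of_inner_self (X : CStarCorrespondence A) {x : X.carrier}
    (h : X.inner x x = 0) : x = 0 := by
  have := X.norm_sq_eq x
  rw [h, norm_zero] at this
  exact norm_eq_zero.1 (pow_eq_zero_iff two_ne_zero |>.1 this)

/-- The balancing relation `x · a ⊗ y = x ⊗ a · y`. -/
theorem tmul_right (X Y : CStarCorrespondence A) (a : A) (x : X.carrier) (y : Y.carrier) :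
    X.tmul Y (X.right a x) y = X.tmul Y x (Y.left a y) := by
  rw [← sub_eq_zero]
  apply eq_zero_of_inner_self
  -- Each of the four terms of the square length becomes `⟨y, a* · ⟨x, x⟩ · a · y⟩`, two with each
  -- sign.
  simp only [map_sub, LinearMap.sub_apply, inner_tmul, X.inner_right, X.inner_right_left, map_mul,
    Y.inner_left, mul_apply_eq_comp]
  abel

theorem norm_right_apply_le (X : CStarCorrespondence A) (a : A) (x : X.carrier) :
    ‖X.right a x‖ ≤ ‖x‖ * ‖a‖ := by
  refine le_of_sq_le_sq ?_ (by positivity)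
  rw [X.norm_sq_eq, X.inner_right, X.inner_right_left, mul_pow, X.norm_sq_eq]
  calc ‖star a * X.inner x x * a‖ ≤ ‖star a‖ * ‖X.inner x x‖ * ‖a‖ :=
        (norm_mul_le _ _).trans (by gcongr; exact norm_mul_le _ _)
    _ = ‖X.inner x x‖ * ‖a‖ ^ 2 := by rw [norm_star]; ring

/-- Boundedness of each operator `X.right a` says nothing about dependence on `a`. Continuity in `a`
is what makes the generation identity a closed condition in `IsGenerator.tmul`. -/
theorem continuous_right_apply (X : CStarCorrespondence A) (x : X.carrier) :
    Continuous fun a => X.right a x :=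
  (LinearMap.mkContinuous ((ContinuousLinearMap.coeLM ℂ ∘ₗ X.right).flip x) ‖x‖
    fun a => X.norm_right_apply_le a x).continuous

theorem right_inner_zero (X : CStarCorrespondence A) (x : X.carrier) :
    X.right (X.inner x 0) x = 0 := by simp

theorem right_inner_add (X : CStarCorrespondence A) (x z w : X.carrier) :
    X.right (X.inner x (z + w)) x = X.right (X.inner x z) x + X.right (X.inner x w) x := by simp

/-- A `C*`-correspondence is generated by the unit vector `x` (for a unit `u` of `A`), with left
action twisted by `α`. -/
structure IsGenerator (X : CStarCorrespondence A) (u : A) (α : A → A) (x : X.carrier) : Prop where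
  inner_self : X.inner x x = u
  eq_right : ∀ z, z = X.right (X.inner x z) x
  left_eq : ∀ a, X.left a x = X.right (α a) x

/-- Moving coefficients through the balanced tensor product gives `a · (x ⊗ y) = x · α a ⊗ y = x ⊗ α
a · y = x ⊗ y · β (α a)`. The condition `β u = u` ensures that `u`, the square length of `x`, does
not alter the length of `y`. -/
theorem IsGenerator.tmul {X Y : CStarCorrespondence A} {u : A} {α β : A → A} {x : X.carrier}
    {y : Y.carrier} (hu : ∀ a, u * a = a) (hβ : β u = u) (hx : X.IsGenerator u α x)
    (hy : Y.IsGenerator u β y) : (X.tensor Y).IsGenerator u (β ∘ α) (X.tmul Y x y) where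
  inner_self := by
    rw [inner_tmul, hx.inner_self, hy.left_eq, hβ, Y.inner_right, hy.inner_self, hu]
  left_eq a := by
    rw [left_tmul, hx.left_eq, tmul_right, hy.left_eq, right_tmul, Function.comp_apply]
  eq_right z := by
    -- Both sides of the identity are continuous in `z`, so it suffices to check the dense image of
    -- the algebraic tensor product, and there elementary tensors by additivity.
    have hcont : Continuous fun z => (X.tensor Y).right
        ((X.tensor Y).inner (X.tmul Y x y) z) (X.tmul Y x y) :=
      ((X.tensor Y).continuous_right_apply _).comp
        ((preTensor X Y).continuous_completionInner_comp continuous_const continuous_id)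
    have hclosed : IsClosed {z : (X.tensor Y).carrier | z = (X.tensor Y).right
        ((X.tensor Y).inner (X.tmul Y x y) z) (X.tmul Y x y)} := isClosed_eq continuous_id hcont
    refine UniformSpace.Completion.induction_on (α := (preTensor X Y).carrier) z hclosed
      fun z => ?_
    induction z using TensorProduct.induction_on with
    | zero =>
      change ((0 : (preTensor X Y).carrier) : UniformSpace.Completion _) = (X.tensor Y).right
        ((X.tensor Y).inner _ ((0 : (preTensor X Y).carrier) : UniformSpace.Completion _)) _
      rw [UniformSpace.Completion.coe_zero]
      exact ((X.tensor Y).right_inner_zero _).symm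
    | tmul a b =>
      change X.tmul Y a b = (X.tensor Y).right ((X.tensor Y).inner _ (X.tmul Y a b)) _
      -- `x ⊗ y · ⟨y, ⟨x, a⟩ · b⟩ = x ⊗ ⟨x, a⟩ · b = x · ⟨x, a⟩ ⊗ b = a ⊗ b`.
      rw [inner_tmul, right_tmul, ← hy.eq_right, ← tmul_right, ← hx.eq_right]
    | add z w hz hw =>
      change (((show (preTensor X Y).carrier from z) + (show (preTensor X Y).carrier from w) :
        (preTensor X Y).carrier) : UniformSpace.Completion _) = (X.tensor Y).right
        ((X.tensor Y).inner _ (((show (preTensor X Y).carrier from z) + (show (preTensor X Y).carrier from w) :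
        (preTensor X Y).carrier) : UniformSpace.Completion _)) _
      rw [UniformSpace.Completion.coe_add]
      refine (congrArg₂ (· + ·) hz hw).trans ?_
      exact ((X.tensor Y).right_inner_add _ _ _).symm

/-- Taking coordinates `z ↦ ⟨x, z⟩` is inverse to `a ↦ x · a`. With trivial twist, `a ⟨x, z⟩ = ⟨x ·
a*, z⟩ = ⟨a* · x, z⟩ = ⟨x, a · z⟩`; the inner product is preserved because `x · ⟨x, z⟩ = z`. -/
theorem IsGenerator.isomorphic_identity {X : CStarCorrespondence A} {u : A} {x : X.carrier}
    (hu : ∀ a, u * a = a) (hx : X.IsGenerator u id x) :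
    X.Isomorphic (identity A) := by
  have h1 : ∀ a, X.inner x (X.right a x) = a := fun a => by
    rw [X.inner_right, hx.inner_self, hu]
  refine ⟨fun z => X.inner x z, ⟨fun z w h => ?_, fun a => ⟨X.right a x, h1 a⟩⟩, fun a z => ?_,
    fun z w => ?_⟩
  · dsimp only at h
    rw [hx.eq_right z, h, ← hx.eq_right w]
  · change X.inner x (X.left a z) = a * X.inner x z
    have h2 : X.inner (X.right (star a) x) z = a * X.inner x z := by
      rw [X.inner_right_left, star_star]
    rw [← h2, ← id_def (a := star a), ← hx.left_eq, X.inner_left, star_star]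
  · change star (X.inner x z) * X.inner x w = X.inner z w
    rw [← X.inner_right_left, ← hx.eq_right]

theorem IsGenerator.tensorPow {X : CStarCorrespondence A} {u : A} {α : A → A} {x : X.carrier}
    (hu : ∀ a, u * a = a) (hα : α u = u) (hx : X.IsGenerator u α x) (n : ℕ) :
    ∃ y, (X.tensorPow (n + 1)).IsGenerator u α^[n + 1] y := by
  induction n with
  | zero => exact ⟨x, hx⟩
  | succ n ih =>
    obtain ⟨y, hy⟩ := ih
    exact ⟨_, hx.tmul hu (Function.iterate_fixed hα _) hy⟩

/-- `x` and `y` are orthogonal, have square length `p`, and are fixed by the projections `q`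
and `q'`. -/
structure IsOrthogonalPair (X : CStarCorrespondence A) (p q q' : A) (x y : X.carrier) : Prop where
  inner_left_self : X.inner x x = p
  inner_right_self : X.inner y y = p
  inner_eq_zero : X.inner x y = 0
  left_fst : X.left q x = x
  left_snd : X.left q' y = y

end CStarCorrespondence

/-! ### Graphs with bijective range and source maps are periodic. -/

namespace DirectedGraph

open CStarCorrespondence Filter Topology

variable {G : DirectedGraph.{u}}

/-- On a finite vertex set every function lies in `C₀`. -/
def toC₀ [Finite G.V] (f : G.V → ℂ) : C₀(G.V, ℂ) where
  toFun := f
  continuous_toFun := continuous_of_discreteTopology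
  zero_at_infty' := by simp

@[simp] theorem toC₀_apply [Finite G.V] (f : G.V → ℂ) (v : G.V) : toC₀ f v = f v := rfl

theorem isVector_of_summable [Finite G.V] {ξ : G.E → ℂ}
    (h : ∀ v, Summable fun e : {e // G.r e = v} => ‖ξ e‖ ^ 2) : G.IsVector ξ :=
  ⟨h, by simp⟩

section generator

variable (hr : Function.Bijective G.r)
include hr

/-- Only one edge ends at `G.r e`, so the sum has a single term. -/
theorem innerFun_apply_range (ξ η : G.vectors) (e : G.E) :
    innerFun ξ η (G.r e) = conj (ξ.1 e) * η.1 e := by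
  rw [innerFun_apply]
  exact tsum_eq_single (⟨e, rfl⟩ : {e' // G.r e' = G.r e})
    fun f hf => absurd (Subtype.ext (hr.1 f.2)) hf

end generator

/-- The generator is the constant function `1`: `⟨1, ξ⟩` is `ξ` transported along `r`. The twist
runs backwards along edges, since the right action reads a function at the range and the left action
at the source. -/
theorem exists_isGenerator [Finite G.V] (hr : Function.Bijective G.r) (τ : G.V → G.V)
    (hτ : ∀ e, τ (G.r e) = G.s e) :
    ∃ x, G.correspondence.IsGenerator (toC₀ 1) (fun a => toC₀ (a ∘ τ)) x := by
  have h1 : G.IsVector (fun _ => (1 : ℂ)) := isVector_of_summable fun v => by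
    have : Finite G.E := Finite.of_injective _ hr.1
    exact Summable.of_finite
  refine ⟨mkVector _ h1, ?_, fun ξ => ?_, fun a => ?_⟩
  · refine ZeroAtInftyContinuousMap.ext fun v => ?_
    obtain ⟨e, rfl⟩ := hr.2 v
    refine (innerFun_apply_range hr _ _ e).trans ?_
    simp [mkVector]
  · refine Subtype.ext (funext fun e => ?_)
    refine Eq.trans ?_ (rightAction_apply _ _ e).symm
    refine Eq.trans ?_ (congrArg _ (innerFun_apply_range hr _ _ e).symm)
    simp [mkVector]
  · refine Subtype.ext (funext fun e => ?_)
    refine (leftAction_apply _ _ e).trans (Eq.trans ?_ (rightAction_apply _ _ e).symm)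
    simp [mkVector, hτ]

theorem not_nonperiodic_of_bijective [Finite G.V] (hr : Function.Bijective G.r)
    (hs : Function.Bijective G.s) : ¬ G.correspondence.Nonperiodic := by
  intro h
  let τ : Equiv.Perm G.V := (Equiv.ofBijective _ hr).symm.trans (Equiv.ofBijective _ hs)
  have hτ : ∀ e, τ (G.r e) = G.s e := fun e => by
    have : (Equiv.ofBijective _ hr).symm (G.r e) = e := (Equiv.ofBijective _ hr).symm_apply_apply e
    change Equiv.ofBijective _ hs ((Equiv.ofBijective _ hr).symm (G.r e)) = _
    rw [this]; rfl
  obtain ⟨x, hx⟩ := exists_isGenerator hr τ hτ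
  -- The power to use is the order of `τ`, positive because `V` is finite. For the empty graph it is
  -- `1`, and indeed `X ≅ A = 0`.
  obtain ⟨n, hn⟩ := Nat.exists_eq_add_one.2 (orderOf_pos τ)
  have hu : ∀ a, toC₀ (G := G) 1 * a = a := fun a => by ext v; simp
  obtain ⟨y, hy⟩ := hx.tensorPow hu (by ext v; simp) n
  have hit : ∀ k (a : C₀(G.V, ℂ)), (fun a : C₀(G.V, ℂ) => toC₀ (a ∘ τ))^[k] a
      = toC₀ (a ∘ (τ ^ k : Equiv.Perm G.V)) := fun k a => by
    induction k with
    | zero => ext v; simp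
    | succ k ih => rw [Function.iterate_succ_apply', ih, pow_succ]; ext v; simp
  have hid : (fun a : C₀(G.V, ℂ) => toC₀ (a ∘ τ))^[n + 1] = id := by
    ext a v
    rw [hit, ← hn, pow_orderOf_eq_one]
    simp
  rw [hid] at hy
  exact absurd (h _ (hy.isomorphic_identity hu)) n.succ_ne_zero

/-! ### Orthogonal path vectors and injectivity of the range map. -/

section paths

open Classical in
/-- The indicator function of an edge. -/
noncomputable def edgeVector [Finite G.V] (e : G.E) : G.correspondence.carrier :=
  mkVector (Pi.single e 1) <| isVector_of_summable fun v => by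
    -- A vertex may receive infinitely many edges, so summability comes from the support being at
    -- most one edge.
    refine summable_of_hasFiniteSupport ((Set.finite_singleton e).preimage
      Subtype.val_injective.injOn |>.subset fun f hf => ?_)
    by_contra hne
    have : f.1 ≠ e := hne
    simp [Pi.single_apply, this] at hf

open Classical in
/-- The indicator function of a vertex. -/
noncomputable def vertexProj [Finite G.V] (v : G.V) : C₀(G.V, ℂ) := toC₀ (Pi.single v 1)

variable [Finite G.V]

theorem inner_edgeVector_self (e : G.E) :
    G.correspondence.inner (edgeVector e) (edgeVector e) = vertexProj (G.r e) := by
  classical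
  refine ZeroAtInftyContinuousMap.ext fun v => ?_
  refine (innerFun_apply _ _ v).trans ?_
  by_cases h : G.r e = v
  · subst h
    rw [tsum_eq_single (⟨e, rfl⟩ : {e' // G.r e' = G.r e}) fun f hf => ?_]
    · simp [edgeVector, mkVector, vertexProj]
    · have : f.1 ≠ e := fun h => hf (Subtype.ext h)
      simp [edgeVector, mkVector, this]
  · have h0 : ∀ f : {e // G.r e = v}, f.1 ≠ e := fun f hf => h (hf ▸ f.2)
    simp [edgeVector, mkVector, h0, vertexProj, Ne.symm h]

theorem inner_edgeVector_of_ne {e f : G.E} (h : e ≠ f) :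
    G.correspondence.inner (edgeVector e) (edgeVector f) = 0 := by
  classical
  refine ZeroAtInftyContinuousMap.ext fun v => ?_
  refine (innerFun_apply _ _ v).trans ?_
  refine (tsum_congr fun d => ?_).trans tsum_zero
  rcases eq_or_ne d.1 e with hd | hd
  · simp [edgeVector, mkVector, hd, h]
  · simp [edgeVector, mkVector, hd]

theorem left_edgeVector (e : G.E) :
    G.correspondence.left (vertexProj (G.s e)) (edgeVector e) = edgeVector e := by
  classical
  refine Subtype.ext (funext fun f => (leftAction_apply _ _ f).trans ?_)
  rcases eq_or_ne f e with rfl | hd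
  · simp [edgeVector, mkVector, vertexProj]
  · simp [edgeVector, mkVector, hd]

/-- The vectors are indicators of two paths of length `n + 1` with last edges `e` and `f`; `v` and
`w` are the starting vertices, recorded so that an edge can be prepended. -/
theorem exists_isOrthogonalPair (hsources : G.NoSources) {e f : G.E} (hef : e ≠ f)
    (h : G.r e = G.r f) (n : ℕ) :
    ∃ v w x y, (G.correspondence.tensorPow (n + 1)).IsOrthogonalPair
      (vertexProj (G.r e)) (vertexProj v) (vertexProj w) x y := by
  induction n with
  | zero =>
    exact ⟨G.s e, G.s f, edgeVector e, edgeVector f, inner_edgeVector_self e,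
      h ▸ inner_edgeVector_self f, inner_edgeVector_of_ne hef, left_edgeVector e, left_edgeVector f⟩
  | succ n ih =>
    obtain ⟨v, w, x, y, hxy⟩ := ih
    obtain ⟨e', rfl⟩ := hsources v
    obtain ⟨f', rfl⟩ := hsources w
    refine ⟨G.s e', G.s f', tmul _ _ (edgeVector e') x, tmul _ _ (edgeVector f') y,
      ?_, ?_, ?_, ?_, ?_⟩
    · exact (inner_tmul _ _ _ _ _ _).trans
        (by rw [inner_edgeVector_self, hxy.left_fst, hxy.inner_left_self])
    · exact (inner_tmul _ _ _ _ _ _).trans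
        (by rw [inner_edgeVector_self, hxy.left_snd, hxy.inner_right_self])
    · refine (inner_tmul _ _ _ _ _ _).trans ?_
      -- The prepended edges may coincide. Then the new inner product reduces to that of `x` and
      -- `y`, which already vanishes; otherwise the edge vectors are orthogonal.
      rcases eq_or_ne e' f' with rfl | hne
      · rw [inner_edgeVector_self, hxy.left_snd, hxy.inner_eq_zero]
      · rw [inner_edgeVector_of_ne hne]
        simp
    · exact (left_tmul _ _ _ _ _).trans (by rw [left_edgeVector])
    · exact (left_tmul _ _ _ _ _).trans (by rw [left_edgeVector])

theorem range_injective_of_isomorphic (hsources : G.NoSources) {n : ℕ}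
    (h : (G.correspondence.tensorPow (n + 1)).Isomorphic (identity C₀(G.V, ℂ))) :
    Function.Injective G.r := by
  classical
  intro e f hef
  by_contra hne
  obtain ⟨v, w, x, y, hxy⟩ := exists_isOrthogonalPair hsources hne hef n
  obtain ⟨Φ, -, -, hΦ⟩ := h
  change _ → C₀(G.V, ℂ) at Φ
  -- Evaluation at the common range turns orthogonality into a vanishing product of two complex
  -- numbers, each of modulus one.
  have key : ∀ z z', conj (Φ z (G.r e)) * Φ z' (G.r e)
      = (G.correspondence.tensorPow (n + 1)).inner z z' (G.r e) := fun z z' =>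
    congrArg (fun a : C₀(G.V, ℂ) => a (G.r e)) (hΦ z z')
  have hx := key x x
  have hy := key y y
  have h0 := key x y
  rw [hxy.inner_left_self] at hx
  rw [hxy.inner_right_self] at hy
  rw [hxy.inner_eq_zero] at h0
  have h1 : vertexProj (G.r e) (G.r e) = 1 := by simp [vertexProj]
  rw [h1] at hx hy
  rcases mul_eq_zero.1 h0 with h2 | h2
  · rw [h2, zero_mul] at hx
    exact zero_ne_one hx
  · rw [h2, mul_zero] at hy
    exact zero_ne_one hy

end paths

/-! ### Disjoint unions of simple cycles as permutations of a finite set. -/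

theorem IsDisjointUnionOfSimpleCycles.bijective (h : G.IsDisjointUnionOfSimpleCycles) :
    Function.Bijective G.r ∧ Function.Bijective G.s := by
  obtain ⟨ι, n, -, φ, ψ, hs, hr⟩ := h
  have hr' : Function.Bijective (disjointUnion fun i => cycle (n i)).r :=
    (Equiv.sigmaCongrRight fun i => finRotate (n i)).bijective
  have hs' : Function.Bijective (disjointUnion fun i => cycle (n i)).s :=
    (Equiv.sigmaCongrRight fun i => Equiv.refl (Fin (n i))).bijective
  constructor
  · have : G.r = φ.symm ∘ (disjointUnion fun i => cycle (n i)).r ∘ ψ :=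
      funext fun e => by simp [hr]
    rw [this]
    exact φ.symm.bijective.comp (hr'.comp ψ.bijective)
  · have : G.s = φ.symm ∘ (disjointUnion fun i => cycle (n i)).s ∘ ψ :=
      funext fun e => by simp [hs]
    rw [this]
    exact φ.symm.bijective.comp (hs'.comp ψ.bijective)

/-- A permutation of a finite type is conjugate to a disjoint union of rotations. -/
theorem exists_equiv_sigma_finRotate {α : Type u} [Finite α] (σ : Equiv.Perm α) :
    ∃ (ι : Type u) (n : ι → ℕ) (φ : (Σ i, Fin (n i)) ≃ α), (∀ i, 1 ≤ n i) ∧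
      ∀ i k, φ ⟨i, finRotate (n i) k⟩ = σ (φ ⟨i, k⟩) := by
  let c : Quotient (Equiv.Perm.SameCycle.setoid σ) → α := Quotient.out
  have hper : ∀ x, x ∈ Function.periodicPts σ := fun x =>
    σ.injective.mem_periodicPts x
  let n := fun i => Function.minimalPeriod σ (c i)
  have hn : ∀ i, 0 < n i := fun i => Function.minimalPeriod_pos_of_mem_periodicPts (hper _)
  -- With a base point chosen in each orbit, every element is reached from its base point by a
  -- unique number of steps below the period.
  let f : (Σ i, Fin (n i)) → α := fun p => σ^[p.2] (c p.1)
  have hsame : ∀ i (k : ℕ), σ.SameCycle (c i) (σ^[k] (c i)) := fun i k =>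
    ⟨k, by simp [Equiv.Perm.iterate_eq_pow]⟩
  have hf : Function.Bijective f := by
    refine ⟨?_, fun x => ?_⟩
    · rintro ⟨i, k⟩ ⟨j, l⟩ h
      change σ^[k] (c i) = σ^[l] (c j) at h
      have hij : i = j := by
        have : σ.SameCycle (c i) (c j) := (hsame i k).trans (h ▸ (hsame j l).symm)
        rw [← Quotient.out_eq i, ← Quotient.out_eq j]
        exact Quotient.sound this
      subst hij
      rw [Function.iterate_eq_iterate_iff_of_lt_minimalPeriod k.2 l.2] at h
      rw [Fin.ext h]
    · obtain ⟨k, hk⟩ := (Quotient.mk_out (s := Equiv.Perm.SameCycle.setoid σ) x :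
        σ.SameCycle _ x).exists_nat_pow_eq
      refine ⟨⟨Quotient.mk _ x, ⟨k % n _, Nat.mod_lt _ (hn _)⟩⟩, ?_⟩
      change σ^[k % Function.minimalPeriod σ _] _ = x
      rw [Function.iterate_mod_minimalPeriod_eq, Equiv.Perm.iterate_eq_pow]
      exact hk
  refine ⟨_, n, Equiv.ofBijective f hf, hn, fun i k => ?_⟩
  change σ^[(finRotate (n i) k : Fin (n i))] (c i) = σ (σ^[k] (c i))
  -- The exponent `k + 1` is reduced modulo the period, matching the wrap-around of `finRotate` at
  -- the last index.
  rw [← Function.iterate_succ_apply' σ, ← Function.iterate_mod_minimalPeriod_eq (n := k.1 + 1)]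
  congr 2
  have := k.neZero
  rw [finRotate_apply, Fin.val_add, Fin.val_one', Nat.add_mod_mod]

/-- Edges are labelled by their sources, and the edge out of `v` ends at `σ v` for `σ = r ∘ s⁻¹`;
the cycles of `σ` are the components. -/
theorem isDisjointUnionOfSimpleCycles_of_bijective [Finite G.V] (hr : Function.Bijective G.r)
    (hs : Function.Bijective G.s) : G.IsDisjointUnionOfSimpleCycles := by
  let S := Equiv.ofBijective _ hs
  obtain ⟨ι, n, φ, hn, hφ⟩ :=
    exists_equiv_sigma_finRotate (S.symm.trans (Equiv.ofBijective _ hr))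
  have hS : ∀ e, S.symm (G.s e) = e := S.symm_apply_apply
  refine ⟨ι, n, hn, φ.symm, S.trans φ.symm, fun e => ?_, fun e => ?_⟩
  · change Sigma.map id (fun i => id) (φ.symm (G.s e)) = φ.symm (G.s e)
    rfl
  · change Sigma.map id (fun i => finRotate (n i)) (φ.symm (G.s e)) = φ.symm (G.r e)
    rw [Equiv.eq_symm_apply]
    refine (hφ _ _).trans ?_
    change G.r (S.symm (φ (φ.symm (G.s e)))) = _
    rw [φ.apply_symm_apply, hS]

end DirectedGraph

theorem mainTheorem6 (E : DirectedGraph.{u}) [Finite E.V]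
    (hsinks : E.NoSinks) (hsources : E.NoSources) :
    E.correspondence.Nonperiodic ↔ ¬ E.IsDisjointUnionOfSimpleCycles := by
  refine ⟨fun h hE => DirectedGraph.not_nonperiodic_of_bijective hE.bijective.1 hE.bijective.2 h,
    fun h n hn => ?_⟩
  by_contra hn0
  obtain ⟨m, rfl⟩ := Nat.exists_eq_succ_of_ne_zero hn0
  have hr : Function.Bijective E.r :=
    ⟨DirectedGraph.range_injective_of_isomorphic hsources hn, hsources⟩
  refine h (DirectedGraph.isDisjointUnionOfSimpleCycles_of_bijective hr ?_)
  -- Transporting `s` along `r` makes it a self-map of the finite set `V`, where surjectivity, i.e.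
  -- the absence of sinks, gives bijectivity.
  let R := Equiv.ofBijective _ hr
  have : Function.Bijective (E.s ∘ R.symm) :=
    Function.Surjective.bijective_of_finite (Function.Surjective.comp hsinks R.symm.surjective)
  exact (Function.Bijective.of_comp_iff _ R.symm.bijective).1 this
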